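/- Let $(\Delta,\mathcal D,\mathbb P)$ be a probability space, $\mathcal X\subseteq\mathbb R^{n}$ a convex set, $c\in\mathbb R^{n}$, and $g:\mathcal X\times\Delta\to\mathbb R$ such that $g(\cdot,\delta)$ is convex on $\mathcal X$ for every $\delta\in\Delta$. For $k\ge 1$ and $(\delta_1,\dots,\delta_k)\in\Delta^k$ consider the scenario program $$\mathcal P_1[\{\delta_i\}_{i=1}^k]:\quad \min_{x\in\mathcal X} c^\top x\quad\text{subject to } g(x,\delta_i)\le 0,\ i=1,\dots,k .$$ Assume that for every $k\ge1$ and every $(\delta_1,\dots,\delta_k)\in\Delta^k$ its feasible set has non-empty interior and it has exactly one minimizer $x_k=x_k(\delta_1,\dots,\delta_k)$, and that the sets $\{(\delta_1,\dots,\delta_k,\delta)\in\Delta^{k+1}: g(x_k(\delta_1,\dots,\delta_k),\delta)>0\}$ are measurable. The $i$-th constraint is called a support constraint of $\mathcal P_1[\{\delta_i\}_{i=1}^k]$ if its removal strictly decreases the optimal value (which may then be $-\infty$). Let $\zeta\in\mathbb N\cup\{0\}$ be such that for every $k\ge1$, with $\mathbb P^k$-probability one, $\mathcal P_1[\{\delta_i\}_{i=1}^k]$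 has at most $\zeta$ support constraints. Let $m\ge1$ with $m\ge\zeta$. Then: 1. With $\mathbb P^m$-probability one there is a set $I\subseteq\{1,\dots,m\}$ with $|I|=\zeta$ such that $x_m(\delta_1,\dots,\delta_m)$ is a minimizer of $\mathcal P_1[\{\delta_i\}_{i\in I}]$. 2. For every $\epsilon\in(0,1)$, $$\mathbb P^m\Big\{(\delta_1,\dots,\delta_m)\in\Delta^m:\ \mathbb P\big(\delta\in\Delta:\ g(x_m(\delta_1,\dots,\delta_m),\delta)>0\big)>\epsilon\Big\}\ \le\ \binom{m}{\zeta}(1-\epsilon)^{m-\zeta}.$$ -/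

import Mathlib

open MeasureTheory

namespace Scenario

noncomputable section

variable {n : ℕ} {Δ ι : Type*}

/-- The feasibility region of the scenario program with samples `δs`:
all `x ∈ X` with `g x (δs i) ≤ 0` for every sample. -/
def feasible (X : Set (EuclideanSpace ℝ (Fin n))) (g : EuclideanSpace ℝ (Fin n) → Δ → ℝ)
    (δs : ι → Δ) : Set (EuclideanSpace ℝ (Fin n)) :=
  {x | x ∈ X ∧ ∀ i, g x (δs i) ≤ 0}

/-- `x` is a minimizer of `cᵀ x` over the feasibility region of the scenario program. -/
def IsMinimizer (c : EuclideanSpace ℝ (Fin n)) (X : Set (EuclideanSpace ℝ (Fin n)))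
    (g : EuclideanSpace ℝ (Fin n) → Δ → ℝ) (δs : ι → Δ) (x : EuclideanSpace ℝ (Fin n)) : Prop :=
  x ∈ feasible X g δs ∧ ∀ y ∈ feasible X g δs, inner ℝ c x ≤ inner ℝ c y

/-- The optimal value of the scenario program, in the extended reals
(`⊥` if the objective is unbounded below, `⊤` if the program is infeasible). -/
def optValue (c : EuclideanSpace ℝ (Fin n)) (X : Set (EuclideanSpace ℝ (Fin n)))
    (g : EuclideanSpace ℝ (Fin n) → Δ → ℝ) (δs : ι → Δ) : EReal :=
  ⨅ x ∈ feasible X g δs, ((inner ℝ c x : ℝ) : EReal)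

/-- The `i`-th constraint is a support constraint: its removal improves the optimal value. -/
def IsSupport (c : EuclideanSpace ℝ (Fin n)) (X : Set (EuclideanSpace ℝ (Fin n)))
    (g : EuclideanSpace ℝ (Fin n) → Δ → ℝ) (δs : ι → Δ) (i : ι) : Prop :=
  optValue c X g (fun j : {j : ι // j ≠ i} => δs j) < optValue c X g δs

/-- The convexity, feasibility and uniqueness assumption on scenario programs. -/
structure IsConvexScenario (c : EuclideanSpace ℝ (Fin n)) (X : Set (EuclideanSpace ℝ (Fin n)))
    (g : EuclideanSpace ℝ (Fin n) → Δ → ℝ) : Prop where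
  convex_domain : Convex ℝ X
  convex_constraint : ∀ δ, ConvexOn ℝ X (fun x => g x δ)
  interior_nonempty : ∀ k : ℕ, 1 ≤ k → ∀ δs : Fin k → Δ, (interior (feasible X g δs)).Nonempty
  existsUnique_minimizer : ∀ k : ℕ, 1 ≤ k → ∀ δs : Fin k → Δ, ∃! x, IsMinimizer c X g δs x

end

end Scenario

/-! Among the sets of constraints that still make `x_m` optimal, take an inclusion-minimal one.
Dropping any member destroys optimality, so within that subprogram every constraint is a support
constraint. Almost surely all subprograms obey the bound `ζ`, so the set has at most `ζ` elements;
padding it with constraints satisfied by `x_m` gives `I` (`IsMinimizer.exists_card_eq`). By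
uniqueness `x_m` is then a function of the samples in `I` alone. The other `m - ζ` samples are
independent of these and all miss its violation region; if that region has probability above `ε`,
this has probability at most `(1 - ε) ^ (m - ζ)` (`measure_pi_large_missed_le`). A union bound over
`I` supplies the binomial factor. The case `ζ = 0` needs its own argument (`ae_violation_eq_zero`),
since uniqueness is assumed only for `k ≥ 1`. -/

namespace Scenario

/-! ### Deterministic part: few constraints determine the minimizer. -/

section Programs

variable {n : ℕ} {Δ ι κ : Type*} {c : EuclideanSpace ℝ (Fin n)}
  {X : Set (EuclideanSpace ℝ (Fin n))} {g : EuclideanSpace ℝ (Fin n) → Δ → ℝ}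

/-- Dropping constraints enlarges the feasibility region. -/
theorem feasible_comp_subset (δs : ι → Δ) (e : κ → ι) :
    feasible X g δs ⊆ feasible X g (δs ∘ e) :=
  fun _ hy => ⟨hy.1, fun k => hy.2 (e k)⟩

/-- Reindexing the samples along a surjection does not change the minimizers. -/
theorem isMinimizer_comp_iff (δs : ι → Δ) {e : κ → ι} (he : Function.Surjective e)
    (x : EuclideanSpace ℝ (Fin n)) :
    IsMinimizer c X g (δs ∘ e) x ↔ IsMinimizer c X g δs x := by
  have : feasible X g (δs ∘ e) = feasible X g δs := by
    ext y
    exact and_congr_right fun _ => (he.forall (p := fun i => g y (δs i) ≤ 0)).symm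
  simp only [IsMinimizer, this]

/-- A minimizer of the program with constraints `κ` that satisfies further constraints minimizes
the more constrained program. -/
theorem IsMinimizer.of_comp {δs : ι → Δ} {e : κ → ι} {x : EuclideanSpace ℝ (Fin n)}
    (h : IsMinimizer c X g (δs ∘ e) x) (hx : x ∈ feasible X g δs) :
    IsMinimizer c X g δs x :=
  ⟨hx, fun y hy => h.2 y (feasible_comp_subset δs e hy)⟩

theorem IsMinimizer.optValue_eq {δs : ι → Δ} {x : EuclideanSpace ℝ (Fin n)}
    (h : IsMinimizer c X g δs x) : optValue c X g δs = ((inner ℝ c x : ℝ) : EReal) :=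
  le_antisymm (iInf₂_le x h.1) (le_iInf₂ fun y hy => EReal.coe_le_coe_iff.2 (h.2 y hy))

/-- If a minimizer stops being one when the `i`-th constraint is removed, then that constraint is a
support constraint. -/
theorem IsMinimizer.isSupport {δs : ι → Δ} {x : EuclideanSpace ℝ (Fin n)}
    (h : IsMinimizer c X g δs x) {i : ι}
    (hi : ¬ IsMinimizer c X g (fun j : {j : ι // j ≠ i} => δs j) x) :
    IsSupport c X g δs i := by
  have hx : x ∈ feasible X g (fun j : {j : ι // j ≠ i} => δs j) :=
    feasible_comp_subset δs Subtype.val h.1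
  obtain ⟨y, hy, hyx⟩ : ∃ y ∈ feasible X g (fun j : {j : ι // j ≠ i} => δs j),
      inner ℝ c y < inner ℝ c x := by
    by_contra! hcon
    exact hi ⟨hx, hcon⟩
  rw [IsSupport, h.optValue_eq]
  exact (iInf₂_le y hy).trans_lt (EReal.coe_lt_coe_iff.2 hyx)

/-- If every nonempty subprogram has at most `ζ` support constraints, then a minimizer is already
determined by some `ζ` of the constraints. -/
theorem IsMinimizer.exists_card_eq {m ζ : ℕ} {δs : Fin m → Δ} {x : EuclideanSpace ℝ (Fin n)}
    (h : IsMinimizer c X g δs x) (hζm : ζ ≤ m)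
    (hsupp : ∀ k, 1 ≤ k → ∀ e : Fin k ↪ Fin m,
      {i : Fin k | IsSupport c X g (δs ∘ e) i}.ncard ≤ ζ) :
    ∃ I : Finset (Fin m), I.card = ζ ∧ IsMinimizer c X g (fun i : I => δs i) x := by
  have huniv : IsMinimizer c X g (fun i : (Finset.univ : Finset (Fin m)) => δs i) x :=
    (isMinimizer_comp_iff δs (fun i => ⟨⟨i, Finset.mem_univ i⟩, rfl⟩) x).2 h
  obtain ⟨J, -, hJ⟩ := exists_minimal_le_of_wellFoundedLT
    (fun I : Finset (Fin m) => IsMinimizer c X g (fun i : I => δs i) x) _ huniv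
  have hJcard : J.card ≤ ζ := by
    rcases Nat.eq_zero_or_pos J.card with h0 | hpos
    · omega
    let e := J.equivFin.symm
    let f : Fin J.card ↪ Fin m := e.toEmbedding.trans (Function.Embedding.subtype _)
    have hmin : IsMinimizer c X g (δs ∘ f) x :=
      (isMinimizer_comp_iff (fun i : J => δs i) e.surjective x).2 hJ.prop
    have hall : {i : Fin J.card | IsSupport c X g (δs ∘ f) i} = Set.univ := by
      refine Set.eq_univ_of_forall fun i => hmin.isSupport fun hi => ?_
      have hmem : (e i : Fin m) ∈ J := (e i).2
      -- Optimality without constraint `i` would contradict the minimality of `J`.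
      have herase : IsMinimizer c X g (fun j : J.erase (e i) => δs j) x := by
        let q : {j : Fin J.card // j ≠ i} → J.erase (e i) := fun j =>
          ⟨e j, Finset.mem_erase.2 ⟨fun hj => j.2 (e.injective (Subtype.ext hj)), (e j).2⟩⟩
        refine (isMinimizer_comp_iff (fun j : J.erase (e i) => δs j) (e := q) ?_ x).1 hi
        rintro ⟨j, hj⟩
        obtain ⟨hne, hjJ⟩ := Finset.mem_erase.1 hj
        refine ⟨⟨e.symm ⟨j, hjJ⟩, ?_⟩, ?_⟩
        · rintro rfl
          simp at hne
        · simp [q]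
      have hle := hJ.le_of_le herase (Finset.erase_subset _ _)
      exact Finset.notMem_erase _ _ (hle hmem)
    have := hsupp J.card hpos f
    rwa [hall, Set.ncard_univ, Nat.card_fin] at this
  obtain ⟨I, hJI, -, hI⟩ := Finset.exists_subsuperset_card_eq (Finset.subset_univ J) hJcard
    (by simpa using hζm)
  refine ⟨I, hI, IsMinimizer.of_comp (e := fun j : J => (⟨j, hJI j.2⟩ : I)) hJ.prop ?_⟩
  exact feasible_comp_subset δs Subtype.val h.1

end Programs

/-! ### Independent samples. -/

section Product

open scoped ENNReal

variable {Δ ι κ : Type*} [MeasurableSpace Δ] [Fintype ι] [Fintype κ]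

/-- Selecting distinct coordinates of i.i.d. samples gives i.i.d. samples. -/
theorem measurePreserving_comp_injective (P : Measure Δ) [IsProbabilityMeasure P] {e : κ → ι}
    (he : Function.Injective e) :
    MeasurePreserving (fun δs : ι → Δ => δs ∘ e) (Measure.pi fun _ => P)
      (Measure.pi fun _ => P) := by
  have hmeas : Measurable fun δs : ι → Δ => δs ∘ e :=
    measurable_pi_lambda _ fun k => measurable_pi_apply (e k)
  refine ⟨hmeas, (Measure.pi_eq fun s hs => ?_).symm⟩
  -- Coordinates outside the range of `e` are unconstrained and contribute a factor 1.
  have hpre : (fun δs : ι → Δ => δs ∘ e) ⁻¹' Set.univ.pi s =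
      Set.univ.pi fun i => {d | ∀ k, e k = i → d ∈ s k} := by
    ext δs
    simp only [Set.mem_preimage, Set.mem_univ_pi, Function.comp_apply, Set.mem_ofPred_eq]
    exact ⟨fun h i k hk => hk ▸ h k, fun h k => h (e k) k rfl⟩
  rw [Measure.map_apply hmeas (.univ_pi hs), hpre, Measure.pi_pi]
  refine (Fintype.prod_of_injective e he _ _ (fun i hi => ?_) fun k => ?_).symm
  · have : {d : Δ | ∀ k, e k = i → d ∈ s k} = Set.univ :=
      Set.eq_univ_of_forall fun d k hk => (hi ⟨k, hk⟩).elim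
    rw [this, measure_univ]
  · congr 1
    ext d
    simp [he.eq_iff]

/-- The probability that the region `{d | (u, d) ∈ S}`, where `u` collects the samples in `I`, has
probability more than `ε` and yet is missed by all samples outside `I`. -/
theorem measure_pi_large_missed_le [DecidableEq ι] (P : Measure Δ) [IsProbabilityMeasure P]
    (I : Finset ι) {S : Set ((I → Δ) × Δ)} (hS : MeasurableSet S) (ε : ℝ≥0∞) :
    (Measure.pi fun _ : ι => P)
        {δs | ε < P {d | ((fun i : I => δs i), d) ∈ S} ∧
          ∀ j ∉ I, ((fun i : I => δs i), δs j) ∉ S}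
      ≤ (1 - ε) ^ (Fintype.card ι - I.card) := by
  let T : Set ((I → Δ) × ({j // j ∉ I} → Δ)) :=
    {p | ε < P (Prod.mk p.1 ⁻¹' S) ∧ ∀ j, (p.1, p.2 j) ∉ S}
  have hT : MeasurableSet T := by
    refine (measurableSet_lt measurable_const
      ((measurable_measure_prodMk_left hS).comp measurable_fst)).inter ?_
    have : {p : (I → Δ) × ({j // j ∉ I} → Δ) | ∀ j, (p.1, p.2 j) ∉ S} =
        ⋂ j, (fun p => (p.1, p.2 j)) ⁻¹' Sᶜ := by
      ext p
      simp
    change MeasurableSet {p : (I → Δ) × ({j // j ∉ I} → Δ) | ∀ j, (p.1, p.2 j) ∉ S}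
    rw [this]
    exact MeasurableSet.iInter fun j =>
      (measurable_fst.prodMk ((measurable_pi_apply j).comp measurable_snd)) hS.compl
  have hpre : {δs : ι → Δ | ε < P {d | ((fun i : I => δs i), d) ∈ S} ∧
      ∀ j ∉ I, ((fun i : I => δs i), δs j) ∉ S} =
      MeasurableEquiv.piEquivPiSubtypeProd (fun _ : ι => Δ) (· ∈ I) ⁻¹' T := by
    ext δs
    exact and_congr_right fun _ => ⟨fun h j => h j j.2, fun h j hj => h ⟨j, hj⟩⟩
  rw [hpre, (measurePreserving_piEquivPiSubtypeProd (fun _ : ι => P) (· ∈ I)).measure_preimage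
    hT.nullMeasurableSet, Measure.prod_apply hT]
  -- With the samples in `I` frozen at `u`, the region is fixed and the remaining samples miss it
  -- independently.
  have hle : ∀ u : I → Δ, (Measure.pi fun _ : {j // j ∉ I} => P) (Prod.mk u ⁻¹' T) ≤
      (1 - ε) ^ (Fintype.card ι - I.card) := by
    intro u
    by_cases hu : ε < P (Prod.mk u ⁻¹' S)
    · have hsub : Prod.mk u ⁻¹' T ⊆ Set.univ.pi fun _ => (Prod.mk u ⁻¹' S)ᶜ :=
        fun w hw j _ => hw.2 j
      refine (measure_mono hsub).trans ?_
      rw [Measure.pi_pi, Finset.prod_const, Finset.card_univ, Fintype.card_subtype_compl,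
        Fintype.card_coe, prob_compl_eq_one_sub (measurable_prodMk_left hS)]
      gcongr
    · have : Prod.mk u ⁻¹' T = ∅ := Set.eq_empty_of_forall_notMem fun w hw => hu hw.1
      simp [this]
  exact (lintegral_mono hle).trans_eq (by simp)

end Product

/-! ### Probabilistic bounds. -/

section Violation

open scoped ENNReal

variable {n : ℕ} {Δ : Type*} [MeasurableSpace Δ] {P : Measure Δ} [IsProbabilityMeasure P]
  {c : EuclideanSpace ℝ (Fin n)} {X : Set (EuclideanSpace ℝ (Fin n))}
  {g : EuclideanSpace ℝ (Fin n) → Δ → ℝ} {x : (k : ℕ) → (Fin k → Δ) → EuclideanSpace ℝ (Fin n)}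
  {ζ : ℕ}

/-- Almost surely some `ζ` constraints determine the minimizer. -/
theorem ae_exists_card_eq
    (hx : ∀ k : ℕ, 1 ≤ k → ∀ δs : Fin k → Δ, IsMinimizer c X g δs (x k δs))
    (hζ : ∀ k : ℕ, 1 ≤ k → ∀ᵐ δs ∂(Measure.pi fun _ : Fin k => P),
      {i : Fin k | IsSupport c X g δs i}.ncard ≤ ζ)
    {m : ℕ} (hm : 1 ≤ m) (hζm : ζ ≤ m) :
    ∀ᵐ δs ∂(Measure.pi fun _ : Fin m => P), ∃ I : Finset (Fin m), I.card = ζ ∧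
      IsMinimizer c X g (fun i : I => δs i) (x m δs) := by
  -- There are only countably many pairs `(k, e)`, so the exceptional null sets can be merged.
  have hall : ∀ᵐ δs ∂(Measure.pi fun _ : Fin m => P), ∀ k, 1 ≤ k → ∀ e : Fin k ↪ Fin m,
      {i : Fin k | IsSupport c X g (δs ∘ e) i}.ncard ≤ ζ := by
    refine ae_all_iff.2 fun k => ?_
    by_cases hk : 1 ≤ k
    · have : ∀ᵐ δs ∂(Measure.pi fun _ : Fin m => P), ∀ e : Fin k ↪ Fin m,
          {i : Fin k | IsSupport c X g (δs ∘ e) i}.ncard ≤ ζ :=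
        ae_all_iff.2 fun e =>
          (measurePreserving_comp_injective P e.injective).quasiMeasurePreserving.ae (hζ k hk)
      exact this.mono fun δs h _ => h
    · exact Filter.Eventually.of_forall fun _ h => (hk h).elim
  exact hall.mono fun δs h => (hx m hm δs).exists_card_eq hζm h

/-- Without support constraints the minimizer almost surely violates almost no constraint. -/
theorem ae_violation_eq_zero (hconv : IsConvexScenario c X g)
    (hx : ∀ k : ℕ, 1 ≤ k → ∀ δs : Fin k → Δ, IsMinimizer c X g δs (x k δs))
    (hζ : ∀ k : ℕ, 1 ≤ k → ∀ᵐ δs ∂(Measure.pi fun _ : Fin k => P),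
      {i : Fin k | IsSupport c X g δs i}.ncard ≤ 0)
    {m : ℕ} (hm : 1 ≤ m) :
    ∀ᵐ δs ∂(Measure.pi fun _ : Fin m => P), P {δ | 0 < g (x m δs) δ} = 0 := by
  -- Add one fresh sample, at index 0. Almost surely `x (m + 1)` minimizes the unconstrained program
  -- over `X`, hence also the program of the `m` old samples, so it equals `x m`; thus `x m`
  -- satisfies the fresh constraint. Fubini concludes.
  have hsucc := ae_exists_card_eq hx hζ (Nat.le_add_left 1 m) (Nat.zero_le _)
  have hmp := (measurePreserving_piFinSuccAbove (fun _ : Fin (m + 1) => P) 0).symm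
  have hprod : ∀ᵐ p : (Fin m → Δ) × Δ ∂((Measure.pi fun _ : Fin m => P).prod P),
      g (x m p.1) p.2 ≤ 0 := by
    filter_upwards [(Measure.measurePreserving_swap.quasiMeasurePreserving.ae
      (hmp.quasiMeasurePreserving.ae hsucc))] with p hp
    obtain ⟨I, hI, hmin⟩ := hp
    obtain rfl := Finset.card_eq_zero.1 hI
    set δs : Fin (m + 1) → Δ :=
      (MeasurableEquiv.piFinSuccAbove (fun _ : Fin (m + 1) => Δ) 0).symm p.swap with hδs
    have htail : δs ∘ Fin.succ = p.1 := by
      ext i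
      simp [hδs, MeasurableEquiv.piFinSuccAbove]
    have hhead : δs 0 = p.2 := by
      simp [hδs, MeasurableEquiv.piFinSuccAbove]
    have hfeas := (hx (m + 1) (Nat.le_add_left 1 m) δs).1
    have hmin' : IsMinimizer c X g p.1 (x (m + 1) δs) := by
      refine IsMinimizer.of_comp (e := fun i : (∅ : Finset (Fin (m + 1))) =>
        (Finset.notMem_empty _ i.2).elim) ?_ (htail ▸ feasible_comp_subset δs Fin.succ hfeas)
      convert hmin using 1
      ext i
      exact (Finset.notMem_empty _ i.2).elim
    rw [← (hconv.existsUnique_minimizer m hm p.1).unique hmin' (hx m hm p.1), ← hhead]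
    exact hfeas.2 0
  filter_upwards [Measure.ae_ae_of_ae_prod hprod] with δs h
  simpa [ae_iff] using h

/-- The violation probability exceeds `ε` with probability at most
`(m.choose ζ) (1 - ε) ^ (m - ζ)`. -/
theorem measure_violation_le (hconv : IsConvexScenario c X g)
    (hx : ∀ k : ℕ, 1 ≤ k → ∀ δs : Fin k → Δ, IsMinimizer c X g δs (x k δs))
    (hmeas : ∀ k : ℕ, 1 ≤ k → MeasurableSet {p : (Fin k → Δ) × Δ | 0 < g (x k p.1) p.2})
    (hζ : ∀ k : ℕ, 1 ≤ k → ∀ᵐ δs ∂(Measure.pi fun _ : Fin k => P),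
      {i : Fin k | IsSupport c X g δs i}.ncard ≤ ζ)
    {m : ℕ} (hm : 1 ≤ m) (hζm : ζ ≤ m) (ε : ℝ≥0∞) :
    (Measure.pi fun _ : Fin m => P) {δs : Fin m → Δ | ε < P {δ : Δ | 0 < g (x m δs) δ}}
      ≤ (m.choose ζ : ℝ≥0∞) * (1 - ε) ^ (m - ζ) := by
  rcases Nat.eq_zero_or_pos ζ with rfl | hpos
  · have : (Measure.pi fun _ : Fin m => P)
        {δs : Fin m → Δ | ε < P {δ : Δ | 0 < g (x m δs) δ}} = 0 := by
      refine measure_eq_zero_iff_ae_notMem.2 ?_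
      filter_upwards [ae_violation_eq_zero hconv hx hζ hm] with δs h
      simp [h]
    simp [this]
  -- The minimizer computed from the samples in `I` only; `x ζ` is a minimizer because `ζ ≥ 1` here.
  let y (I : Finset (Fin m)) (hI : I.card = ζ) (u : I → Δ) : EuclideanSpace ℝ (Fin n) :=
    x ζ (u ∘ (I.equivFinOfCardEq hI).symm)
  let B (I : Finset (Fin m)) : Set (Fin m → Δ) :=
    {δs | ∃ hI : I.card = ζ, ε < P {d | 0 < g (y I hI fun i => δs i) d} ∧
      ∀ j ∉ I, ¬ 0 < g (y I hI fun i => δs i) (δs j)}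
  have hB : ∀ I ∈ (Finset.univ : Finset (Fin m)).powersetCard ζ,
      (Measure.pi fun _ : Fin m => P) (B I) ≤ (1 - ε) ^ (m - ζ) := by
    intro I hI
    have hcard := (Finset.mem_powersetCard.1 hI).2
    let S : Set ((I → Δ) × Δ) := {p | 0 < g (y I hcard p.1) p.2}
    have hS : MeasurableSet S := by
      have hq : Measurable fun p : (I → Δ) × Δ =>
          (p.1 ∘ (I.equivFinOfCardEq hcard).symm, p.2) :=
        (measurable_pi_lambda _ fun k =>
          (measurable_pi_apply _).comp measurable_fst).prodMk measurable_snd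
      exact hq (hmeas ζ hpos)
    have := measure_pi_large_missed_le P I hS ε
    rw [Fintype.card_fin, hcard] at this
    exact (measure_mono fun δs h => h.2).trans this
  have hcover : ∀ᵐ δs ∂(Measure.pi fun _ : Fin m => P),
      δs ∈ {δs : Fin m → Δ | ε < P {δ : Δ | 0 < g (x m δs) δ}} →
        δs ∈ ⋃ I ∈ (Finset.univ : Finset (Fin m)).powersetCard ζ, B I := by
    filter_upwards [ae_exists_card_eq hx hζ hm hζm] with δs h hδs
    obtain ⟨I, hI, hmin⟩ := h
    have heq : x m δs = y I hI fun i => δs i :=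
      (hconv.existsUnique_minimizer ζ hpos _).unique
        ((isMinimizer_comp_iff (fun i : I => δs i)
          (I.equivFinOfCardEq hI).symm.surjective _).2 hmin) (hx ζ hpos _)
    refine Set.mem_biUnion (Finset.mem_powersetCard.2 ⟨Finset.subset_univ I, hI⟩) ⟨hI, ?_⟩
    rw [← heq]
    exact ⟨hδs, fun j _ => not_lt.2 ((hx m hm δs).1.2 j)⟩
  calc _ ≤ _ := measure_mono_ae hcover
    _ ≤ ∑ I ∈ (Finset.univ : Finset (Fin m)).powersetCard ζ,
        (Measure.pi fun _ : Fin m => P) (B I) := measure_biUnion_finset_le _ _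
    _ ≤ ∑ _I ∈ (Finset.univ : Finset (Fin m)).powersetCard ζ, (1 - ε) ^ (m - ζ) :=
        Finset.sum_le_sum hB
    _ = _ := by simp

end Violation

end Scenario

theorem mainTheorem6 {n : ℕ} {Δ : Type*} [MeasurableSpace Δ] (P : Measure Δ)
    [IsProbabilityMeasure P]
    (c : EuclideanSpace ℝ (Fin n)) (X : Set (EuclideanSpace ℝ (Fin n)))
    (g : EuclideanSpace ℝ (Fin n) → Δ → ℝ)
    (hconv : Scenario.IsConvexScenario c X g)
    -- the minimizer `x k δs` of the scenario program with `k` samples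
    (x : (k : ℕ) → (Fin k → Δ) → EuclideanSpace ℝ (Fin n))
    (hx : ∀ k : ℕ, 1 ≤ k → ∀ δs : Fin k → Δ, Scenario.IsMinimizer c X g δs (x k δs))
    -- measurability of the violation sets
    (hmeas : ∀ k : ℕ, 1 ≤ k → MeasurableSet {p : (Fin k → Δ) × Δ | 0 < g (x k p.1) p.2})
    -- almost surely there are at most `ζ` support constraints
    (ζ : ℕ)
    (hζ : ∀ k : ℕ, 1 ≤ k → ∀ᵐ δs ∂(Measure.pi fun _ : Fin k => P),
      {i : Fin k | Scenario.IsSupport c X g δs i}.ncard ≤ ζ)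
    (m : ℕ) (hm : 1 ≤ m) (hζm : ζ ≤ m) :
    (∀ᵐ δs ∂(Measure.pi fun _ : Fin m => P), ∃ I : Finset (Fin m), I.card = ζ ∧
      Scenario.IsMinimizer c X g (fun i : I => δs i) (x m δs)) ∧
    ∀ ε : ℝ, 0 < ε → ε < 1 →
      (Measure.pi fun _ : Fin m => P).real
          {δs : Fin m → Δ | ε < P.real {δ : Δ | 0 < g (x m δs) δ}}
        ≤ (m.choose ζ : ℝ) * (1 - ε) ^ (m - ζ) := by
  refine ⟨Scenario.ae_exists_card_eq hx hζ hm hζm, fun ε hε0 hε1 => ?_⟩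
  have h := Scenario.measure_violation_le hconv hx hmeas hζ hm hζm (ENNReal.ofReal ε)
  have hset : {δs : Fin m → Δ | ε < P.real {δ : Δ | 0 < g (x m δs) δ}} =
      {δs : Fin m → Δ | ENNReal.ofReal ε < P {δ : Δ | 0 < g (x m δs) δ}} := by
    ext δs
    exact (ENNReal.ofReal_lt_iff_lt_toReal hε0.le (measure_ne_top _ _)).symm
  rw [hset, measureReal_def]
  refine ENNReal.toReal_le_of_le_ofReal
    (mul_nonneg (Nat.cast_nonneg _) (pow_nonneg (sub_nonneg.2 hε1.le) _)) (h.trans_eq ?_)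
  rw [ENNReal.ofReal_mul (Nat.cast_nonneg _), ENNReal.ofReal_natCast,
    ENNReal.ofReal_pow (sub_nonneg.2 hε1.le), ENNReal.ofReal_sub _ hε0.le, ENNReal.ofReal_one]
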